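/- Let $\mathcal H$ be an infinite-dimensional separable complex Hilbert space, let $C$ be a trace-class operator and $T$ a compact operator on $\mathcal H$. Assume that one of $C,T$ is normal and that the other one is upper or lower triangular with respect to some orthonormal basis $(e_n)_{n\in\mathbb N}$ of $\mathcal H$, where an operator $A$ is called upper (lower) triangular with respect to $(e_n)_{n\in\mathbb N}$ if $\langle e_j,Ae_k\rangle=0$ whenever $j>k$ (respectively $j<k$). Then $$\overline{P_C(T)}\subseteq\overline{W_C(T)}.$$ Here $W_C(T)=\{\operatorname{tr}(CU^\dagger TU)\mid U\in\mathcal B(\mathcal H)\text{ unitary}\}$ is the $C$-numerical range of $T$, and $$P_C(T)=\Big\{\sum_{n=1}^\infty\gamma_n\tau_{\sigma(n)}\ \Big|\ \sigma:\mathbb N\to\mathbb N\text{ a permutation}\Big\}$$ is the $C$-spectrum of $T$, where $(\gamma_n)$ and $(\tau_n)$ are the modified eigenvalue sequences of $C$ and $T$. The eigenvalue sequence of a compact operator $K$ lists its non-zero eigenvalues in order of decreasing absolute value, each repeated according to its (finite) algebraic multiplicity, and is filled up with zeros if there are only finitely many of them. The modified eigenvalue sequence of $K$ is the eigenvalue sequence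 itself if the range of $K$ is finite-dimensional; it is the eigenvalue sequence preceded by $\dim\ker K$ zeros if the range of $K$ is infinite-dimensional and $\ker K$ is finite-dimensional; and it is the eigenvalue sequence with infinitely many zeros mixed in if both the range and the kernel of $K$ are infinite-dimensional. (The set $P_C(T)$ does not depend on the remaining choices of order and mixing.) -/

import Mathlib

open scoped InnerProductSpace

namespace CNumRange

variable {H : Type*} [NormedAddCommGroup H] [InnerProductSpace ℂ H] [CompleteSpace H]

/-- `C` is trace class: it is compact and has a Schmidt decomposition
`C = ∑ₙ sₙ ⟨fₙ, ·⟩ gₙ` (convergence in operator norm) with orthonormal sequences `f`, `g` and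
decreasing nonnegative singular numbers `sₙ` such that `∑ₙ sₙ < ∞`. -/
def IsTraceClass (C : H →L[ℂ] H) : Prop :=
  IsCompactOperator C ∧
    ∃ (s : ℕ → ℝ) (f g : ℕ → H), Antitone s ∧ (∀ n, 0 ≤ s n) ∧ Summable s ∧
      Orthonormal ℂ f ∧ Orthonormal ℂ g ∧
      HasSum (fun n => (s n : ℂ) • (innerSL ℂ (f n)).smulRight (g n)) C

/-- `z` is the trace of `A`: the sum `∑ₙ ⟨bₙ, A bₙ⟩` converges to `z` for every orthonormal basis
`b` of `H`. (In an infinite-dimensional separable Hilbert space all orthonormal bases are countably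
infinite, so they are indexed by `ℕ`; and there is at least one.) -/
def HasTrace (A : H →L[ℂ] H) (z : ℂ) : Prop :=
  ∀ b : HilbertBasis ℕ ℂ H, HasSum (fun n => ⟪b n, A (b n)⟫_ℂ) z

/-- The `C`-numerical range `W_C(T) = {tr(C U† T U) | U unitary}`. -/
def cNumericalRange (C T : H →L[ℂ] H) : Set ℂ :=
  {z | ∃ U ∈ unitary (H →L[ℂ] H),
    HasTrace (C ∘L ContinuousLinearMap.adjoint U ∘L T ∘L U) z}

/-- The algebraic multiplicity of `μ` for `T`: the dimension of `⋃ₙ ker (T - μ)ⁿ`. For compact `T`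
and `μ ≠ 0` this union is a finite-dimensional space `ker (T - μ)ⁿ⁰`. -/
noncomputable def algMultiplicity (T : H →L[ℂ] H) (μ : ℂ) : ℕ :=
  Module.finrank ℂ (Module.End.maxGenEigenspace (T : H →ₗ[ℂ] H) μ)

/-- `e` is an eigenvalue sequence of the compact operator `T`: the absolute values decrease and each
`μ ≠ 0` occurs as often as its algebraic multiplicity. Since the absolute values decrease, a zero
can only be followed by zeros, so zeros occur exactly if they have to fill up the sequence. -/
structure IsEigenvalueSeq (T : H →L[ℂ] H) (e : ℕ → ℂ) : Prop where
  antitone_norm : Antitone fun n => ‖e n‖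
  encard_eq : ∀ μ : ℂ, μ ≠ 0 → {n | e n = μ}.encard = algMultiplicity T μ

/-- `τ` is a modified eigenvalue sequence of the compact operator `T`. -/
def IsModifiedEigenvalueSeq (T : H →L[ℂ] H) (τ : ℕ → ℂ) : Prop :=
  ∃ e : ℕ → ℂ, IsEigenvalueSeq T e ∧
    -- finite-dimensional range: the eigenvalue sequence is left unchanged
    (FiniteDimensional ℂ T.range → τ = e) ∧
    -- infinite-dimensional range, finite-dimensional kernel: `dim ker T` zeros are put in front
    (¬ FiniteDimensional ℂ T.range → FiniteDimensional ℂ T.ker →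
      (∀ n < Module.finrank ℂ T.ker, τ n = 0) ∧
        ∀ n, τ (n + Module.finrank ℂ T.ker) = e n) ∧
    -- infinite-dimensional range and kernel: infinitely many zeros are mixed in
    (¬ FiniteDimensional ℂ T.range → ¬ FiniteDimensional ℂ T.ker →
      ∃ φ : ℕ → ℕ, StrictMono φ ∧ (Set.range φ)ᶜ.Infinite ∧
        (∀ n, τ (φ n) = e n) ∧ ∀ m ∉ Set.range φ, τ m = 0)

/-- The `C`-spectrum `P_C(T)`: the sums `∑ₙ γₙ τ_{σ(n)}` over all permutations `σ` of `ℕ`, for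
modified eigenvalue sequences `γ` of `C` and `τ` of `T`. (The possible choices of `γ` and `τ` are
rearrangements of one another, so allowing all of them does not change the set.) -/
def cSpectrum (C T : H →L[ℂ] H) : Set ℂ :=
  {z | ∃ γ τ : ℕ → ℂ, IsModifiedEigenvalueSeq C γ ∧ IsModifiedEigenvalueSeq T τ ∧
    ∃ σ : Equiv.Perm ℕ, HasSum (fun n => γ n * τ (σ n)) z}

/-- `A` is upper triangular with respect to some orthonormal basis. -/
def IsUpperTriangular (A : H →L[ℂ] H) : Prop :=
  ∃ b : HilbertBasis ℕ ℂ H, ∀ j k : ℕ, k < j → ⟪b j, A (b k)⟫_ℂ = 0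

/-- `A` is lower triangular with respect to some orthonormal basis. -/
def IsLowerTriangular (A : H →L[ℂ] H) : Prop :=
  ∃ b : HilbertBasis ℕ ℂ H, ∀ j k : ℕ, j < k → ⟪b j, A (b k)⟫_ℂ = 0

end CNumRange

/-! Diagonalise the normal operator in an orthonormal basis (`exists_hilbertBasis_of_isStarNormal`)
and keep the triangularising basis of the other one. Say `g` belongs to `C` and `b` to `T`. If a
unitary `U` sends `g n` to `b (π n)`, then, one operator being diagonal, the `n`-th diagonal entry
of `C U† T U` in `g` is the product of the diagonal entries of `C` at `g n` and of `T` at `b (π n)`.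
Hence every rearranged sum of such products lies in `W_C(T)` (`mem_cNumericalRange_of_hasSum`).

It remains to compare diagonals with modified eigenvalue sequences. For a compact triangular
operator each non-zero `μ` occurs on the diagonal as often as its algebraic multiplicity
(`encard_diagonal_eq_algMultiplicity`): beyond a finite corner the operator has norm below `‖μ‖`, so
the triangular corner alone determines the multiplicity.

The number of zeros on the diagonal may still differ from that in the modified sequence. Closures
absorb this: one sequence is summable and the other tends to zero, so a zero term can be imitated by
a far-out small one (`mem_closure_rearrangement_sums`). -/

namespace CNumRange

variable {H : Type*} [NormedAddCommGroup H] [InnerProductSpace ℂ H] [CompleteSpace H]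

open Module End ContinuousLinearMap

/-! ### Diagonalisation of compact normal operators -/

/-- A normal operator and its adjoint have the same eigenvectors, with conjugate eigenvalues. -/
theorem adjoint_apply_of_isStarNormal {K : H →L[ℂ] H} (hK : IsStarNormal K) {μ : ℂ} {x : H}
    (hx : K x = μ • x) : adjoint K x = (starRingEnd ℂ) μ • x := by
  have hN : IsStarNormal (K - algebraMap ℂ (H →L[ℂ] H) μ) := by
    refine ⟨?_⟩
    have h1 := hK.star_comm_self
    rw [star_sub, ← algebraMap_star_comm]
    exact ((h1.sub_left (Algebra.commutes _ _)).sub_right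
      ((Algebra.commutes _ _ : Commute _ _).symm))
  have h := (ContinuousLinearMap.IsStarNormal.adjoint_apply_eq_zero_iff hN x).2
    (by simp [Algebra.algebraMap_eq_smul_one, hx])
  rw [← star_eq_adjoint, star_sub, ← algebraMap_star_comm] at h
  simpa [Algebra.algebraMap_eq_smul_one, sub_eq_zero, star_eq_adjoint] using h

theorem orthogonalFamily_eigenspaces_of_isStarNormal {K : H →L[ℂ] H} (hK : IsStarNormal K) :
    OrthogonalFamily ℂ (fun μ => eigenspace (K : H →ₗ[ℂ] H) μ)
      fun μ => (eigenspace (K : H →ₗ[ℂ] H) μ).subtypeₗᵢ := by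
  rintro μ ν hμν ⟨v, hv⟩ ⟨w, hw⟩
  rw [mem_eigenspace_iff] at hv hw
  have h1 : ⟪v, K w⟫_ℂ = ν * ⟪v, w⟫_ℂ := by
    rw [show K w = ν • w from hw, inner_smul_right]
  have h2 : ⟪v, K w⟫_ℂ = μ * ⟪v, w⟫_ℂ := by
    rw [← adjoint_inner_left, adjoint_apply_of_isStarNormal hK hv, inner_smul_left]
    simp
  have h3 : (μ - ν) * ⟪v, w⟫_ℂ = 0 := by rw [sub_mul, ← h1, ← h2, sub_self]
  exact (mul_eq_zero.1 h3).resolve_left (sub_ne_zero.2 hμν)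

/-- The eigenspaces of a compact normal operator have trivial orthogonal complement. -/
theorem orthogonal_iSup_eigenspaces_eq_bot_of_isStarNormal {K : H →L[ℂ] H}
    (hc : IsCompactOperator K) (hK : IsStarNormal K) :
    (⨆ μ, eigenspace (K : H →ₗ[ℂ] H) μ)ᗮ = ⊥ := by
  set p : Submodule ℂ H := (⨆ μ, eigenspace (K : H →ₗ[ℂ] H) μ)ᗮ with hp
  have hmem : ∀ x, x ∈ p ↔ ∀ μ : ℂ, ∀ v : H, K v = μ • v → ⟪v, x⟫_ℂ = 0 := by
    intro x
    rw [hp, ← Submodule.iInf_orthogonal]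
    simp [Submodule.mem_orthogonal]
  have hinv : ∀ x ∈ p, K x ∈ p := by
    intro x hx
    rw [hmem] at hx ⊢
    intro μ v hv
    rw [← adjoint_inner_left, adjoint_apply_of_isStarNormal hK hv, inner_smul_left, hx μ v hv,
      mul_zero]
  have hinv' : ∀ x ∈ p, adjoint K x ∈ p := by
    intro x hx
    rw [hmem] at hx ⊢
    intro μ v hv
    rw [adjoint_inner_right, hv, inner_smul_left, hx μ v hv, mul_zero]
  let S : p →L[ℂ] p := K.restrict hinv
  let S' : p →L[ℂ] p := (adjoint K).restrict hinv'
  have hS' : adjoint S = S' := by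
    symm
    rw [eq_adjoint_iff]
    intro x y
    exact adjoint_inner_left K (y : H) (x : H)
  have hSn : IsStarNormal S := by
    rw [isStarNormal_iff_norm_eq_adjoint]
    intro v
    rw [hS']
    exact isStarNormal_iff_norm_eq_adjoint.1 hK (v : H)
  have hSc : IsCompactOperator S := hc.restrict' hinv
  -- An eigenvector of the restriction would be an eigenvector of `K` orthogonal to all
  -- eigenvectors, hence to itself.
  have hne : ∀ μ, ¬ HasEigenvalue (S : p →ₗ[ℂ] p) μ := by
    intro μ hμ
    obtain ⟨v, hv⟩ := hμ.exists_hasEigenvector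
    have h1 : K (v : H) = μ • (v : H) := congrArg Subtype.val hv.apply_eq_smul
    have h2 := (hmem _).1 v.2 μ v h1
    exact hv.2 (Subtype.ext (inner_self_eq_zero.1 h2))
  have hS0 : ∀ v, S v = 0 := by
    suffices h : ‖S‖₊ = 0 by
      intro v
      have h1 : ‖S‖ = 0 := congrArg NNReal.toReal h
      exact norm_le_zero_iff.1 ((S.le_opNorm v).trans (by rw [h1, zero_mul]))
    -- For normal `S` the norm is the spectral radius, and non-zero spectral values of a compact
    -- operator are eigenvalues.
    rw [← ENNReal.coe_eq_zero, ← IsStarNormal.spectralRadius_eq_nnnorm S,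
      spectralRadius]
    simp only [ENNReal.iSup_eq_zero, ENNReal.coe_eq_zero, nnnorm_eq_zero]
    intro μ hμ
    by_contra h0
    exact hne μ ((hSc.hasEigenvalue_iff_mem_spectrum h0).2 hμ)
  rw [Submodule.eq_bot_iff]
  intro x hx
  by_contra h0
  have : K x = (0 : ℂ) • x := by
    rw [zero_smul]
    exact congrArg Subtype.val (hS0 ⟨x, hx⟩)
  exact h0 (inner_self_eq_zero.1 ((hmem x).1 hx 0 x this))

/-- An orthonormal family in a separable space is countable. -/
theorem countable_of_orthonormal {E : Type*} [NormedAddCommGroup E] [InnerProductSpace ℂ E]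
    [TopologicalSpace.SeparableSpace E] {ι : Type*} {v : ι → E}
    (hv : Orthonormal ℂ v) : Countable ι := by
  have hd : Pairwise (Function.onFun Disjoint fun i => Metric.ball (v i) (1 / 2)) := by
    intro i j hij
    refine Metric.ball_disjoint_ball ?_
    -- Distinct members are `√2 > 1` apart, so balls of radius `1 / 2` are disjoint.
    have h : ‖v i - v j‖ ^ 2 = 2 := by
      rw [@norm_sub_sq ℂ, hv.1 i, hv.1 j, hv.2 hij]
      norm_num
    rw [dist_eq_norm]
    nlinarith [norm_nonneg (v i - v j)]
  exact hd.countable_of_isOpen_disjoint (fun i => Metric.isOpen_ball)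
    (fun i => ⟨v i, Metric.mem_ball_self (by norm_num)⟩)

/-- A compact normal operator is diagonal in some orthonormal basis. -/
theorem exists_hilbertBasis_of_isStarNormal [TopologicalSpace.SeparableSpace H]
    (hH : ¬ FiniteDimensional ℂ H) {K : H →L[ℂ] H}
    (hc : IsCompactOperator K) (hK : IsStarNormal K) :
    ∃ (g : HilbertBasis ℕ ℂ H) (d : ℕ → ℂ), ∀ n, K (g n) = d n • g n := by
  classical
  have hcl : ∀ μ, CompleteSpace (eigenspace (K : H →ₗ[ℂ] H) μ) := by
    intro μ
    have : IsClosed (eigenspace (K : H →ₗ[ℂ] H) μ : Set H) := by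
      have : (eigenspace (K : H →ₗ[ℂ] H) μ : Set H) = {x | K x = μ • x} := by
        ext x; simp
      rw [this]
      exact isClosed_eq K.continuous (continuous_const_smul μ)
    exact this.completeSpace_coe
  choose w b hb using fun μ : ℂ => exists_hilbertBasis ℂ (eigenspace (K : H →ₗ[ℂ] H) μ)
  have hortho := orthogonalFamily_eigenspaces_of_isStarNormal hK
  let v : (Σ μ, w μ) → H := fun a => (b a.1 a.2 : H)
  have hv : Orthonormal ℂ v := hortho.orthonormal_sigma_orthonormal (fun μ => (b μ).orthonormal)
  have hspan : (Submodule.span ℂ (Set.range v))ᗮ = ⊥ := by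
    rw [← orthogonal_iSup_eigenspaces_eq_bot_of_isStarNormal hc hK]
    refine le_antisymm ?_ (Submodule.orthogonal_le ?_)
    · rw [← Submodule.orthogonal_closure (Submodule.span ℂ (Set.range v))]
      refine Submodule.orthogonal_le (iSup_le fun μ x hx => ?_)
      have h1 := (b μ).hasSum_repr ⟨x, hx⟩
      have h2 := h1.mapL (eigenspace (K : H →ₗ[ℂ] H) μ).subtypeL
      refine (Submodule.isClosed_topologicalClosure _).mem_of_tendsto h2
        (Filter.Eventually.of_forall fun s => Submodule.sum_mem _ fun i _ => ?_)
      refine Submodule.le_topologicalClosure _ ?_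
      rw [map_smul]
      exact Submodule.smul_mem _ _ (Submodule.subset_span ⟨⟨μ, i⟩, rfl⟩)
    · rw [Submodule.span_le]
      rintro _ ⟨⟨μ, i⟩, rfl⟩
      exact Submodule.mem_iSup_of_mem μ (b μ i).2
  let B := HilbertBasis.mkOfOrthogonalEqBot hv hspan
  have hcount : Countable (Σ μ, w μ) := countable_of_orthonormal hv
  have hinf : Infinite (Σ μ, w μ) := by
    by_contra hfin
    rw [not_infinite_iff_finite] at hfin
    have := Fintype.ofFinite (Σ μ, w μ)
    exact hH B.toOrthonormalBasis.toBasis.finiteDimensional_of_finite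
  obtain ⟨e⟩ : Nonempty (ℕ ≃ Σ μ, w μ) := by
    have := (nonempty_denumerable_iff (α := Σ μ, w μ)).2 ⟨hcount, hinf⟩
    exact ⟨(@Denumerable.eqv _ this.some).symm⟩
  refine ⟨HilbertBasis.mkOfOrthogonalEqBot (hv.comp e e.injective)
    (by rw [e.surjective.range_comp]; exact hspan), fun n => (e n).1, fun n => ?_⟩
  rw [HilbertBasis.coe_mkOfOrthogonalEqBot]
  exact mem_eigenspace_iff.1 (b (e n).1 (e n).2).2

end CNumRange

/-! ### Traces of products with a trace-class operator -/

namespace CNumRange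

variable {H : Type*} [NormedAddCommGroup H] [InnerProductSpace ℂ H] [CompleteSpace H]

open ContinuousLinearMap

/-- Termwise AM-GM followed by Bessel. The bound is uniform over unit vectors, which makes the
double series for the trace absolutely summable. -/
theorem summable_and_tsum_norm_inner_mul_inner_le {E : Type*} [NormedAddCommGroup E] [InnerProductSpace ℂ E]
    (b : HilbertBasis ℕ ℂ E) (x y : E) :
    Summable (fun n => ‖⟪x, b n⟫_ℂ * ⟪b n, y⟫_ℂ‖) ∧
      ∑' n, ‖⟪x, b n⟫_ℂ * ⟪b n, y⟫_ℂ‖ ≤ (‖x‖ ^ 2 + ‖y‖ ^ 2) / 2 := by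
  have hx := b.orthonormal.inner_products_summable x
  have hy := b.orthonormal.inner_products_summable y
  have hle : ∀ n, ‖⟪x, b n⟫_ℂ * ⟪b n, y⟫_ℂ‖ ≤
      (‖⟪b n, x⟫_ℂ‖ ^ 2 + ‖⟪b n, y⟫_ℂ‖ ^ 2) / 2 := by
    intro n
    rw [norm_mul, norm_inner_symm x]
    nlinarith [sq_nonneg (‖⟪b n, x⟫_ℂ‖ - ‖⟪b n, y⟫_ℂ‖)]
  have hs := ((hx.add hy).div_const 2)
  have hs' := Summable.of_nonneg_of_le (fun n => norm_nonneg _) hle hs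
  refine ⟨hs', (hs'.tsum_le_tsum hle hs).trans ?_⟩
  rw [tsum_div_const, hx.tsum_add hy]
  have := b.orthonormal.tsum_inner_products_le x
  have := b.orthonormal.tsum_inner_products_le y
  linarith

/-- The product of a trace-class operator and a bounded operator has a trace. -/
theorem IsTraceClass.exists_hasTrace_comp {C : H →L[ℂ] H} (hC : IsTraceClass C) (B : H →L[ℂ] H) :
    ∃ z, HasTrace (C ∘L B) z := by
  obtain ⟨-, s, f, g, -, hs0, hs, hf, hg, hsum⟩ := hC
  refine ⟨∑' k, (s k : ℂ) * ⟪adjoint B (f k), g k⟫_ℂ, fun b => ?_⟩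
  -- Summing `F` over the second index gives terms free of `b`; summing over the first gives the
  -- diagonal entries. Fubini equates the two totals.
  let F : ℕ × ℕ → ℂ := fun p => s p.1 * (⟪adjoint B (f p.1), b p.2⟫_ℂ * ⟪b p.2, g p.1⟫_ℂ)
  have hF1 : ∀ k, HasSum (fun n => F (k, n)) ((s k : ℂ) * ⟪adjoint B (f k), g k⟫_ℂ) := fun k =>
    (b.hasSum_inner_mul_inner _ _).mul_left _
  have hF2 : ∀ n, HasSum (fun k => F (k, n)) ⟪b n, (C ∘L B) (b n)⟫_ℂ := by
    intro n
    have h := (hsum.mapL (ContinuousLinearMap.apply ℂ H (B (b n)))).mapL (innerSL ℂ (b n))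
    convert! h using 2 with k
    simp [F, adjoint_inner_left]
  have hFs : Summable F := by
    refine Summable.of_norm ?_
    rw [summable_prod_of_nonneg (fun p => norm_nonneg _)]
    have hk : ∀ k, (fun n => ‖F (k, n)‖) =
        fun n => s k * ‖⟪adjoint B (f k), b n⟫_ℂ * ⟪b n, g k⟫_ℂ‖ := by
      intro k
      funext n
      simp only [F]
      rw [norm_mul, Complex.norm_of_nonneg (hs0 k)]
    refine ⟨fun k => ?_, ?_⟩
    · rw [hk]
      exact (summable_and_tsum_norm_inner_mul_inner_le b _ _).1.mul_left _
    · refine Summable.of_nonneg_of_le (fun k => tsum_nonneg fun n => norm_nonneg _) (fun k => ?_)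
        (hs.mul_right ((‖adjoint B‖ ^ 2 + 1) / 2))
      rw [hk, tsum_mul_left]
      refine mul_le_mul_of_nonneg_left ?_ (hs0 k)
      refine (summable_and_tsum_norm_inner_mul_inner_le b _ _).2.trans ?_
      rw [hg.1 k]
      have : ‖adjoint B (f k)‖ ≤ ‖adjoint B‖ := by
        simpa [hf.1 k] using (adjoint B).le_opNorm (f k)
      gcongr
      norm_num
  have h1 := hFs.hasSum.prod_fiberwise hF1
  have h2 : HasSum (F ∘ Prod.swap) (∑' p, F p) :=
    (Equiv.prodComm ℕ ℕ).hasSum_iff.2 hFs.hasSum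
  rw [h1.tsum_eq]
  exact h2.prod_fiberwise hF2

theorem IsTraceClass.summable_inner {C : H →L[ℂ] H} (hC : IsTraceClass C)
    (b : HilbertBasis ℕ ℂ H) : Summable fun n => ⟪b n, C (b n)⟫_ℂ := by
  obtain ⟨z, hz⟩ := hC.exists_hasTrace_comp (ContinuousLinearMap.id ℂ H)
  exact (hz b).summable

end CNumRange

/-! ### Algebraic multiplicities under restriction and quotient; tail projections -/

namespace CNumRange

open Module End

theorem mem_maxGenEigenspace_iff_exists_pow {V : Type*} [AddCommGroup V] [Module ℂ V]
    (f : End ℂ V) (μ : ℂ) (x : V) :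
    x ∈ f.maxGenEigenspace μ ↔ ∃ k : ℕ, ((f - algebraMap ℂ (End ℂ V) μ) ^ k) x = 0 := by
  rw [mem_maxGenEigenspace]
  rfl

/-- If `f` restricts to `g` on an invariant subspace and `f - μ` is injective on the quotient, then
`f` and `g` have the same algebraic multiplicity at `μ`. -/
theorem finrank_maxGenEigenspace_eq_of_injective {V W : Type*} [AddCommGroup V] [Module ℂ V]
    [AddCommGroup W] [Module ℂ W] (f : End ℂ W) (g : End ℂ V) (i : V →ₗ[ℂ] W) (μ : ℂ)
    (hi : Function.Injective i) (hfg : ∀ v, f (i v) = i (g v))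
    (hq : ∀ x, f x - μ • x ∈ LinearMap.range i → x ∈ LinearMap.range i) :
    finrank ℂ (f.maxGenEigenspace μ) = finrank ℂ (g.maxGenEigenspace μ) := by
  have hpow : ∀ (k : ℕ) (v : V), ((f - algebraMap ℂ (End ℂ W) μ) ^ k) (i v) =
      i (((g - algebraMap ℂ (End ℂ V) μ) ^ k) v) := by
    intro k
    induction k with
    | zero => intro v; simp
    | succ k ih =>
      intro v
      rw [pow_succ, pow_succ, Module.End.mul_apply, Module.End.mul_apply, ← ih]
      simp [hfg]
  have hr : ∀ (k : ℕ) (x : W), ((f - algebraMap ℂ (End ℂ W) μ) ^ k) x ∈ LinearMap.range i →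
      x ∈ LinearMap.range i := by
    intro k
    induction k with
    | zero => intro x hx; simpa using hx
    | succ k ih =>
      intro x hx
      rw [pow_succ, Module.End.mul_apply] at hx
      exact hq x (by simpa using ih _ hx)
  have hmap : (g.maxGenEigenspace μ).map i = f.maxGenEigenspace μ := by
    ext x
    simp only [Submodule.mem_map, mem_maxGenEigenspace_iff_exists_pow]
    constructor
    · rintro ⟨v, ⟨k, hk⟩, rfl⟩
      exact ⟨k, by rw [hpow, hk, map_zero]⟩
    · rintro ⟨k, hk⟩
      obtain ⟨v, rfl⟩ := hr k x (by rw [hk]; exact Submodule.zero_mem _)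
      exact ⟨v, ⟨k, hi (by rw [← hpow, hk, map_zero])⟩, rfl⟩
  rw [← hmap]
  exact (LinearEquiv.finrank_eq (Submodule.equivMapOfInjective i hi _)).symm

/-- If `f` induces `g` on the quotient by an invariant subspace on which `f - μ` is bijective, then
`f` and `g` have the same algebraic multiplicity at `μ`. -/
theorem finrank_maxGenEigenspace_eq_of_surjective {V W : Type*} [AddCommGroup V] [Module ℂ V]
    [AddCommGroup W] [Module ℂ W] (f : End ℂ W) (g : End ℂ V) (π : W →ₗ[ℂ] V) (μ : ℂ)
    (hπ : Function.Surjective π) (hfg : ∀ x, π (f x) = g (π x))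
    (hinj : ∀ x, π x = 0 → f x - μ • x = 0 → x = 0)
    (hsurj : ∀ y, π y = 0 → ∃ x, π x = 0 ∧ f x - μ • x = y) :
    finrank ℂ (f.maxGenEigenspace μ) = finrank ℂ (g.maxGenEigenspace μ) := by
  have hpow : ∀ (k : ℕ) (x : W), π (((f - algebraMap ℂ (End ℂ W) μ) ^ k) x) =
      ((g - algebraMap ℂ (End ℂ V) μ) ^ k) (π x) := by
    intro k
    induction k with
    | zero => intro v; simp
    | succ k ih =>
      intro v
      rw [pow_succ, pow_succ, Module.End.mul_apply, Module.End.mul_apply, ih]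
      simp [hfg]
  have hinj' : ∀ (k : ℕ) (x : W), π x = 0 → ((f - algebraMap ℂ (End ℂ W) μ) ^ k) x = 0 →
      x = 0 := by
    intro k
    induction k with
    | zero => intro x _ hx; simpa using hx
    | succ k ih =>
      intro x hx hk
      rw [pow_succ, Module.End.mul_apply] at hk
      refine hinj x hx ?_
      have := ih _ (by simp [hfg, hx]) hk
      simpa using this
  have hsurj' : ∀ (k : ℕ) (y : W), π y = 0 →
      ∃ x, π x = 0 ∧ ((f - algebraMap ℂ (End ℂ W) μ) ^ k) x = y := by
    intro k
    induction k with
    | zero => intro y hy; exact ⟨y, hy, by simp⟩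
    | succ k ih =>
      intro y hy
      obtain ⟨z, hz, rfl⟩ := ih y hy
      obtain ⟨x, hx, rfl⟩ := hsurj z hz
      exact ⟨x, hx, by rw [pow_succ, Module.End.mul_apply]; simp⟩
  have hmap : (f.maxGenEigenspace μ).map π = g.maxGenEigenspace μ := by
    ext v
    simp only [Submodule.mem_map, mem_maxGenEigenspace_iff_exists_pow]
    constructor
    · rintro ⟨x, ⟨k, hk⟩, rfl⟩
      exact ⟨k, by rw [← hpow, hk, map_zero]⟩
    · rintro ⟨k, hk⟩
      obtain ⟨x, rfl⟩ := hπ v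
      -- A lift `x` is a generalised eigenvector only modulo the kernel of `π`; subtracting `w` from
      -- that kernel removes the defect.
      obtain ⟨w, hw, hwx⟩ := hsurj' k (((f - algebraMap ℂ (End ℂ W) μ) ^ k) x) (by rw [hpow, hk])
      exact ⟨x - w, ⟨k, by rw [map_sub, hwx, sub_self]⟩, by rw [map_sub, hw, sub_zero]⟩
  have hi : Function.Injective (π.domRestrict (f.maxGenEigenspace μ)) := by
    rw [injective_iff_map_eq_zero]
    rintro ⟨x, hx⟩ h0
    obtain ⟨k, hk⟩ := (mem_maxGenEigenspace_iff_exists_pow _ _ _).1 hx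
    exact Subtype.ext (hinj' k x h0 hk)
  rw [← hmap, ← LinearMap.range_domRestrict]
  exact (LinearMap.finrank_range_of_inj hi).symm

/-- The multiplicity is that of `μ` as a root of the characteristic polynomial, which transposition
preserves and which factors over the diagonal. -/
theorem finrank_maxGenEigenspace_toLin'_of_isUpperTriangular {n : ℕ} (M : Matrix (Fin n) (Fin n) ℂ)
    (h : M.IsUpperTriangular ∨ M.transpose.IsUpperTriangular) (μ : ℂ) :
    finrank ℂ (maxGenEigenspace (Matrix.toLin' M) μ) =
      (Finset.univ.filter fun i => M i i = μ).card := by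
  classical
  have hc : M.charpoly = ∏ i, (Polynomial.X - Polynomial.C (M i i)) := by
    rcases h with h | h
    · exact Matrix.charpoly_of_isUpperTriangular M h
    · rw [← Matrix.charpoly_transpose, Matrix.charpoly_of_isUpperTriangular _ h]
      rfl
  rw [LinearMap.finrank_maxGenEigenspace_eq, Matrix.charpoly_toLin', hc, ← Polynomial.count_roots,
    Polynomial.roots_prod _ _ (Finset.prod_ne_zero_iff.2 fun i _ => Polynomial.X_sub_C_ne_zero _)]
  simp only [Polynomial.roots_X_sub_C, Multiset.bind_singleton]
  rw [Multiset.count_map]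
  simp [Finset.card, eq_comm]

section Tail

variable {H : Type*} [NormedAddCommGroup H] [InnerProductSpace ℂ H]

/-- The orthogonal projection onto the closed span of the basis vectors `b n, b (n + 1), …`. -/
noncomputable def tailProj (b : HilbertBasis ℕ ℂ H) (n : ℕ) : H →L[ℂ] H :=
  ContinuousLinearMap.id ℂ H - ∑ i ∈ Finset.range n, (innerSL ℂ (b i)).smulRight (b i)

theorem tailProj_apply (b : HilbertBasis ℕ ℂ H) (n : ℕ) (x : H) :
    tailProj b n x = x - ∑ i ∈ Finset.range n, ⟪b i, x⟫_ℂ • b i := by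
  simp [tailProj]

theorem inner_tailProj (b : HilbertBasis ℕ ℂ H) (n i : ℕ) (x : H) :
    ⟪b i, tailProj b n x⟫_ℂ = if i < n then 0 else ⟪b i, x⟫_ℂ := by
  classical
  rw [tailProj_apply, inner_sub_right, inner_sum]
  simp only [inner_smul_right, orthonormal_iff_ite.1 b.orthonormal, mul_ite, mul_one, mul_zero,
    Finset.sum_ite_eq, Finset.mem_range]
  split_ifs <;> simp

theorem ext_inner_hilbertBasis (b : HilbertBasis ℕ ℂ H) {x y : H}
    (h : ∀ i, ⟪b i, x⟫_ℂ = ⟪b i, y⟫_ℂ) : x = y := by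
  refine b.repr.injective (lp.ext (funext fun i => ?_))
  rw [b.repr_apply_apply, b.repr_apply_apply, h]

theorem tailProj_eq_self (b : HilbertBasis ℕ ℂ H) {n : ℕ} {x : H}
    (h : ∀ i < n, ⟪b i, x⟫_ℂ = 0) : tailProj b n x = x :=
  ext_inner_hilbertBasis b fun i => by
    rw [inner_tailProj]
    split_ifs with hi
    · exact (h i hi).symm
    · rfl

theorem tailProj_tailProj (b : HilbertBasis ℕ ℂ H) (n : ℕ) (x : H) :
    tailProj b n (tailProj b n x) = tailProj b n x :=
  tailProj_eq_self b fun i hi => by rw [inner_tailProj, if_pos hi]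

theorem inner_tailProj_left (b : HilbertBasis ℕ ℂ H) (n : ℕ) (x y : H) :
    ⟪tailProj b n x, y⟫_ℂ = ⟪x, tailProj b n y⟫_ℂ := by
  rw [← (b.hasSum_inner_mul_inner (tailProj b n x) y).tsum_eq,
    ← (b.hasSum_inner_mul_inner x (tailProj b n y)).tsum_eq]
  congr 1
  funext i
  rw [inner_tailProj, ← inner_conj_symm (tailProj b n x), inner_tailProj]
  split_ifs <;> simp

theorem norm_tailProj_le (b : HilbertBasis ℕ ℂ H) (n : ℕ) (x : H) : ‖tailProj b n x‖ ≤ ‖x‖ := by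
  have h : ‖tailProj b n x‖ ^ 2 ≤ ‖x‖ * ‖tailProj b n x‖ := by
    rw [← inner_self_eq_norm_sq (𝕜 := ℂ), inner_tailProj_left, tailProj_tailProj]
    exact re_inner_le_norm _ _
  by_contra! hlt
  nlinarith [norm_nonneg x]

theorem tendsto_tailProj (b : HilbertBasis ℕ ℂ H) (x : H) :
    Filter.Tendsto (fun n => tailProj b n x) Filter.atTop (nhds 0) := by
  have h := (b.hasSum_repr x).tendsto_sum_nat
  simp only [b.repr_apply_apply] at h
  simp only [tailProj_apply]
  simpa using h.const_sub x

/-- Tail projections are contractions tending strongly to zero, so they are uniformly small on the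
totally bounded image of the unit ball. -/
theorem exists_norm_tailProj_comp_le (b : HilbertBasis ℕ ℂ H) {K : H →L[ℂ] H}
    (hK : IsCompactOperator K) {ε : ℝ} (hε : 0 < ε) :
    ∃ n, ∀ x, ‖tailProj b n (K x)‖ ≤ ε * ‖x‖ := by
  have htb : TotallyBounded (K '' Metric.closedBall 0 1) :=
    (hK.isCompact_closure_image_closedBall (𝕜₁ := ℂ) (f := (K : H →ₗ[ℂ] H)) 1).totallyBounded.subset
      subset_closure
  obtain ⟨s, hs, hcov⟩ := Metric.totallyBounded_iff.1 htb (ε / 2) (by positivity)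
  have hev : ∀ᶠ n in Filter.atTop, ∀ y ∈ s, ‖tailProj b n y‖ < ε / 2 := by
    rw [Filter.eventually_all_finite hs]
    intro y _
    have := (tendsto_tailProj b y).norm
    rw [norm_zero] at this
    exact this.eventually (gt_mem_nhds (by positivity))
  obtain ⟨n, hn⟩ := hev.exists
  have key : ∀ x, ‖x‖ ≤ 1 → ‖tailProj b n (K x)‖ ≤ ε := by
    intro x hx
    obtain ⟨y, hy, hxy⟩ := Set.mem_iUnion₂.1 (hcov ⟨x, by simpa using hx, rfl⟩)
    rw [Metric.mem_ball, dist_eq_norm] at hxy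
    have h1 : tailProj b n (K x) = tailProj b n (K x - y) + tailProj b n y := by
      rw [map_sub, sub_add_cancel]
    rw [h1]
    have h2 := norm_add_le (tailProj b n (K x - y)) (tailProj b n y)
    have h3 := norm_tailProj_le b n (K x - y)
    have h4 := hn y hy
    linarith
  refine ⟨n, fun x => ?_⟩
  exact ContinuousLinearMap.le_of_opNorm_le (f := (tailProj b n) ∘L K)
    (ContinuousLinearMap.opNorm_le_of_unit_norm hε.le fun x hx => key x hx.le) x

/-- With `P` the tail projection, `‖K P x‖² = ⟨P K†K P x, P x⟩`, so the previous estimate for the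
compact operator `K†K` with `ε ^ 2` suffices. -/
theorem exists_norm_comp_tailProj_le [CompleteSpace H] (b : HilbertBasis ℕ ℂ H) {K : H →L[ℂ] H}
    (hK : IsCompactOperator K) {ε : ℝ} (hε : 0 < ε) :
    ∃ n, ∀ x, ‖K (tailProj b n x)‖ ≤ ε * ‖x‖ := by
  have hK' : IsCompactOperator (ContinuousLinearMap.adjoint K ∘L K) :=
    hK.clm_comp (ContinuousLinearMap.adjoint K)
  obtain ⟨n, hn⟩ := exists_norm_tailProj_comp_le b hK' (show 0 < ε ^ 2 by positivity)
  refine ⟨n, fun x => ?_⟩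
  have h : ‖K (tailProj b n x)‖ ^ 2 ≤ (ε * ‖x‖) ^ 2 := by
    rw [← inner_self_eq_norm_sq (𝕜 := ℂ), ← ContinuousLinearMap.adjoint_inner_left]
    nth_rewrite 2 [← tailProj_tailProj]
    rw [← inner_tailProj_left]
    refine (re_inner_le_norm _ _).trans ?_
    have h1 := hn (tailProj b n x)
    have h2 := norm_tailProj_le b n x
    calc _ ≤ (ε ^ 2 * ‖x‖) * ‖x‖ := by
          refine mul_le_mul (h1.trans ?_) h2 (norm_nonneg _) (by positivity)
          gcongr
      _ = _ := by ring
  exact (sq_le_sq₀ (norm_nonneg _) (by positivity)).1 h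

/-- The diagonal of a compact operator is a null sequence. -/
theorem tendsto_inner_apply_self (b : HilbertBasis ℕ ℂ H) {K : H →L[ℂ] H}
    (hK : IsCompactOperator K) :
    Filter.Tendsto (fun n => ⟪b n, K (b n)⟫_ℂ) Filter.atTop (nhds 0) := by
  rw [Metric.tendsto_atTop]
  intro ε hε
  obtain ⟨n, hn⟩ := exists_norm_tailProj_comp_le b hK (half_pos hε)
  refine ⟨n, fun m hm => ?_⟩
  have h1 : ⟪b m, K (b m)⟫_ℂ = ⟪b m, tailProj b n (K (b m))⟫_ℂ := by
    rw [inner_tailProj, if_neg (by omega)]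
  rw [dist_zero_right, h1]
  have h2 := norm_inner_le_norm (𝕜 := ℂ) (b m) (tailProj b n (K (b m)))
  have h3 := hn (b m)
  rw [b.orthonormal.1 m] at h2 h3
  linarith

end Tail

end CNumRange

/-! ### Rearranged sums and the irrelevance of zeros -/

namespace CNumRange

/-- If `τ` and `t` have the same non-zero values
with the same multiplicities and `t` is null, then finitely many terms of `τ` can be matched
injectively with nearby terms of `t`. -/
theorem exists_injective_norm_sub_lt {τ t : ℕ → ℂ}
    (e : {n // τ n ≠ 0} ≃ {n // t n ≠ 0}) (he : ∀ n, t (e n) = τ n)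
    (ht : Filter.Tendsto t Filter.atTop (nhds 0)) (F : Finset ℕ) {δ : ℝ} (hδ : 0 < δ) :
    ∃ p : F → ℕ, Function.Injective p ∧ ∀ n : F, ‖t (p n) - τ n‖ < δ := by
  classical
  obtain ⟨N, hN⟩ := Metric.tendsto_atTop.1 ht δ hδ
  let B : ℕ → ℕ := fun n => if h : τ n ≠ 0 then e ⟨n, h⟩ else 0
  let m := (F.sup B) + N + 1
  -- Non-zero terms are matched exactly. Zero terms go to `m + n`, past every exact match and past
  -- `N`, where `t` is below `δ`.
  refine ⟨fun n => if τ n ≠ 0 then B n else m + n, ?_, ?_⟩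
  · intro i j hij
    have hBm : ∀ n : F, B n < m := fun n => by
      have := Finset.le_sup (f := B) n.2
      omega
    dsimp only at hij
    split_ifs at hij with hi hj hj
    · simp only [B, dif_pos hi, dif_pos hj] at hij
      have := e.injective (Subtype.ext hij)
      exact Subtype.ext (Subtype.mk.inj this)
    · have := hBm i
      omega
    · have := hBm j
      omega
    · exact Subtype.ext (by omega)
  · intro n
    dsimp only
    split_ifs with h
    · simp only [B, dif_pos h]
      rw [he]
      simpa using hδ
    · push Not at h
      rw [h]
      simpa using hN (m + n) (by omega)

/-- Sums of products of a summable and a null sequence over all rearrangements: up to closure,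
the set of sums depends only on the non-zero values of the sequences and their multiplicities. -/
theorem mem_closure_rearrangement_sums {γ γ' τ t : ℕ → ℂ}
    (eγ : {n // γ n ≠ 0} ≃ {n // γ' n ≠ 0}) (heγ : ∀ n, γ' (eγ n) = γ n)
    (eτ : {n // τ n ≠ 0} ≃ {n // t n ≠ 0}) (heτ : ∀ n, t (eτ n) = τ n)
    (hγ' : Summable γ') (ht : Filter.Tendsto t Filter.atTop (nhds 0)) (σ : Equiv.Perm ℕ) {z : ℂ}
    (hz : HasSum (fun n => γ n * τ (σ n)) z) :
    z ∈ closure {w | ∃ π : Equiv.Perm ℕ, HasSum (fun n => γ' n * t (π n)) w} := by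
  classical
  obtain ⟨M, hM0, hM⟩ : ∃ M > 0, ∀ n, ‖t n‖ ≤ M := by
    obtain ⟨M, hM⟩ := (Metric.isBounded_range_of_tendsto t ht).exists_norm_le
    exact ⟨max M 1, by positivity, fun n => (hM _ ⟨n, rfl⟩).trans (le_max_left _ _)⟩
  have hτM : ∀ n, ‖τ n‖ ≤ M := by
    intro n
    by_cases h : τ n = 0
    · simpa [h] using hM0.le
    · rw [← heτ ⟨n, h⟩]
      exact hM _
  -- The pairing `σ` is transported to the indices of `γ'`: `a n` is the value of `τ` paired with
  -- `γ' n`, set to `0` where `γ' n = 0` makes it immaterial.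
  let q : {n // γ' n ≠ 0} → ℕ := fun n => σ (eγ.symm n)
  have hq : Function.Injective q := fun i j hij =>
    eγ.symm.injective (Subtype.ext (σ.injective hij))
  let a : ℕ → ℂ := fun n => if h : γ' n ≠ 0 then τ (q ⟨n, h⟩) else 0
  have ha : ∀ n, ‖a n‖ ≤ M := by
    intro n
    dsimp only [a]
    split_ifs
    · exact hτM _
    · simpa using hM0.le
  have hza : HasSum (fun n => γ' n * a n) z := by
    have h1 : HasSum (fun n : {n // γ n ≠ 0} => γ n * τ (σ n)) z :=
      (hasSum_subtype_iff_of_support_subset (s := {n | γ n ≠ 0}) (fun n hn => by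
        intro h; apply hn; simp [h])).2 hz
    have h2 : HasSum (fun n : {n // γ' n ≠ 0} => γ' n * a n) z := by
      rw [← eγ.hasSum_iff]
      convert h1 using 2 with n
      have h3 := (eγ n).2
      simp only [Function.comp, a, dif_pos h3, q, heγ]
      simp
    exact (hasSum_subtype_iff_of_support_subset (s := {n | γ' n ≠ 0}) (fun n hn => by
        intro h; apply hn; simp [h])).1 h2
  rw [Metric.mem_closure_iff]
  intro ε hε
  have hγn := hγ'.norm
  set S := ∑' n, ‖γ' n‖
  have hS0 : 0 ≤ S := tsum_nonneg fun n => norm_nonneg _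
  -- a finite set of indices carrying almost all of `γ'`
  obtain ⟨F, hF⟩ : ∃ F : Finset ℕ, S - ε / (8 * M) < ∑ n ∈ F, ‖γ' n‖ :=
    ((hγn.hasSum.eventually (lt_mem_nhds (show S - ε / (8 * M) < S by
      have : 0 < ε / (8 * M) := by positivity
      linarith))).exists)
  let G := F.filter fun n => γ' n ≠ 0
  have hG : ∑ n ∈ G, ‖γ' n‖ = ∑ n ∈ F, ‖γ' n‖ := by
    refine Finset.sum_filter_of_ne fun n _ hn => ?_
    simpa using hn
  have hGmem : ∀ n ∈ G, γ' n ≠ 0 := fun n hn => (Finset.mem_filter.1 hn).2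
  -- The errors inside and outside `G` are at most `S * δ` and `2 * M * (ε / (8 * M))`, each at most
  -- `ε / 4`; `S + 1` avoids division by zero.
  let δ := ε / (4 * (S + 1))
  have hδ : 0 < δ := by positivity
  let Q : G → ℕ := fun n => q ⟨n, hGmem n n.2⟩
  have hQ : Function.Injective Q := fun i j hij => by
    have := hq hij
    exact Subtype.ext (Subtype.mk.inj this)
  obtain ⟨p, hp, hpδ⟩ := exists_injective_norm_sub_lt eτ heτ ht (Finset.univ.image Q) hδ
  let r : G → ℕ := fun n => p ⟨Q n, Finset.mem_image_of_mem _ (Finset.mem_univ n)⟩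
  have hr : Function.Injective r := fun i j hij => hQ (congrArg Subtype.val (hp hij))
  -- Only finitely many values of the permutation are prescribed, so the injection `r` extends to
  -- all of `ℕ`.
  obtain ⟨π, hπ⟩ := Equiv.Perm.exists_extending_pair (fun n : G => (n : ℕ)) r
    Subtype.val_injective hr
  have hsum : Summable fun n => γ' n * t (π n) :=
    Summable.of_norm_bounded (hγn.mul_right M) fun n => by
      rw [norm_mul]
      exact mul_le_mul_of_nonneg_left (hM _) (norm_nonneg _)
  refine ⟨_, ⟨π, hsum.hasSum⟩, ?_⟩
  have hd : HasSum (fun n => γ' n * (a n - t (π n))) (z - ∑' n, γ' n * t (π n)) := by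
    simpa [mul_sub] using hza.sub hsum.hasSum
  have hin : ∀ n ∈ G, ‖γ' n * (a n - t (π n))‖ ≤ ‖γ' n‖ * δ := by
    intro n hn
    rw [norm_mul]
    refine mul_le_mul_of_nonneg_left ?_ (norm_nonneg _)
    have h1 : π n = r ⟨n, hn⟩ := hπ ⟨n, hn⟩
    have h2 : a n = τ (Q ⟨n, hn⟩) := by
      simp only [a, dif_pos (hGmem n hn), Q]
    rw [h1, h2, norm_sub_rev]
    exact (hpδ _).le
  have hout : ∀ n, ‖γ' n * (a n - t (π n))‖ ≤ ‖γ' n‖ * (2 * M) := by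
    intro n
    rw [norm_mul]
    refine mul_le_mul_of_nonneg_left ((norm_sub_le _ _).trans ?_) (norm_nonneg _)
    linarith [ha n, hM (π n)]
  have hle : ∀ n, ‖γ' n * (a n - t (π n))‖ ≤
      ‖γ' n‖ * δ + (‖γ' n‖ - if n ∈ G then ‖γ' n‖ else 0) * (2 * M) := by
    intro n
    split_ifs with h
    · simpa using hin n h
    · have h1 := hout n
      have h2 : 0 ≤ ‖γ' n‖ * δ := by positivity
      rw [sub_zero]
      linarith
  have hind : HasSum (fun n => if n ∈ G then ‖γ' n‖ else 0) (∑ n ∈ G, ‖γ' n‖) := by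
    have := hasSum_sum_of_ne_finset_zero (L := SummationFilter.unconditional ℕ)
      (f := fun n => if n ∈ G then ‖γ' n‖ else 0)
      (s := G)
      (fun n hn => if_neg hn)
    convert this using 1
    exact Finset.sum_congr rfl fun n hn => (if_pos hn).symm
  have hbound := (hγn.hasSum.mul_right δ).add ((hγn.hasSum.sub hind).mul_right (2 * M))
  have hfin : ‖z - ∑' n, γ' n * t (π n)‖ ≤ S * δ + (S - ∑ n ∈ G, ‖γ' n‖) * (2 * M) := by
    rw [← hd.tsum_eq]
    exact tsum_of_norm_bounded hbound hle
  rw [dist_eq_norm]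
  refine hfin.trans_lt ?_
  have h1 : S * δ ≤ ε / 4 := by
    simp only [δ]
    rw [mul_div_assoc', div_le_div_iff₀ (by positivity) (by norm_num)]
    nlinarith
  have h2 : (S - ∑ n ∈ G, ‖γ' n‖) * (2 * M) ≤ ε / 4 := by
    have h3 : S - ∑ n ∈ G, ‖γ' n‖ ≤ ε / (8 * M) := by rw [hG]; linarith
    calc _ ≤ ε / (8 * M) * (2 * M) := by gcongr
      _ = ε / 4 := by field_simp; norm_num
  linarith

/-- Sequences in which each non-zero value occurs equally often have bijective supports. -/
theorem exists_equiv_support {x y : ℕ → ℂ}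
    (h : ∀ μ : ℂ, μ ≠ 0 → {n | x n = μ}.encard = {n | y n = μ}.encard) :
    ∃ e : {n // x n ≠ 0} ≃ {n // y n ≠ 0}, ∀ n, y (e n) = x n := by
  have key : ∀ c : ℂ,
      Nonempty ({a : {n // x n ≠ 0} // x a = c} ≃ {b : {n // y n ≠ 0} // y b = c}) := by
    intro c
    by_cases hc : c = 0
    · subst hc
      exact ⟨⟨fun a => (a.1.2 a.2).elim, fun b => (b.1.2 b.2).elim, fun a => (a.1.2 a.2).elim,
        fun b => (b.1.2 b.2).elim⟩⟩
    · have hh := h c hc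
      have e1 : ∀ w : ℕ → ℂ, Nonempty ({a : {n // w n ≠ 0} // w a = c} ≃ {n | w n = c}) :=
        fun w => ⟨⟨fun a => ⟨a.1, a.2⟩, fun a => ⟨⟨a.1, by
            have h1 : w a.1 = c := a.2
            rw [h1]; exact hc⟩, a.2⟩, fun a => rfl, fun a => rfl⟩⟩
      obtain ⟨f⟩ := e1 x
      obtain ⟨g⟩ := e1 y
      have hcard : Cardinal.mk {n | x n = c} = Cardinal.mk {n | y n = c} := by
        rw [← Cardinal.toENat_eq_iff_of_le_aleph0 (Cardinal.mk_le_aleph0) (Cardinal.mk_le_aleph0)]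
        exact hh
      obtain ⟨k⟩ := Cardinal.eq.1 hcard
      exact ⟨f.trans (k.trans g.symm)⟩
  have k := fun c => (key c).some
  exact ⟨Equiv.ofFiberEquiv k, Equiv.ofFiberEquiv_map k⟩

end CNumRange

/-! ### Diagonal entries of compact triangular operators -/

namespace CNumRange

variable {H : Type*} [NormedAddCommGroup H] [InnerProductSpace ℂ H]

open Module End

/-- The upper left `n × n` corner of the matrix of `K` in the basis `b`. -/
noncomputable def corner (b : HilbertBasis ℕ ℂ H) (K : H →L[ℂ] H) (n : ℕ) :
    Matrix (Fin n) (Fin n) ℂ := Matrix.of fun i j => ⟪b i, K (b j)⟫_ℂ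

theorem hasSum_inner_apply [CompleteSpace H] (b : HilbertBasis ℕ ℂ H) (K : H →L[ℂ] H) (i : ℕ) (x : H) :
    HasSum (fun j => ⟪b i, K (b j)⟫_ℂ * ⟪b j, x⟫_ℂ) ⟪b i, K x⟫_ℂ := by
  have h := b.hasSum_inner_mul_inner (ContinuousLinearMap.adjoint K (b i)) x
  simpa only [ContinuousLinearMap.adjoint_inner_left] using h

/-- The span of the first `n` basis vectors is invariant and `K` acts there as the corner. On the
quotient `K` has norm below `‖μ‖`, so `K - μ` is injective there. -/
theorem algMultiplicity_eq_finrank_corner_of_upper (b : HilbertBasis ℕ ℂ H) {K : H →L[ℂ] H}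
    (hb : ∀ j k : ℕ, k < j → ⟪b j, K (b k)⟫_ℂ = 0) {μ : ℂ} {n : ℕ} {ε : ℝ} (hε : ε < ‖μ‖)
    (hn : ∀ x, ‖tailProj b n (K x)‖ ≤ ε * ‖x‖) :
    algMultiplicity K μ = finrank ℂ (maxGenEigenspace (Matrix.toLin' (corner b K n)) μ) := by
  classical
  let i : (Fin n → ℂ) →ₗ[ℂ] H := Fintype.linearCombination ℂ fun j : Fin n => b j
  have hi : ∀ v, i v = ∑ j, v j • b j := fun v => Fintype.linearCombination_apply ..
  have hinner : ∀ (v : Fin n → ℂ) (k : ℕ), ⟪b k, i v⟫_ℂ = if h : k < n then v ⟨k, h⟩ else 0 := by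
    intro v k
    rw [hi, inner_sum]
    simp only [inner_smul_right, orthonormal_iff_ite.1 b.orthonormal, mul_ite, mul_one, mul_zero]
    split_ifs with h
    · rw [Finset.sum_eq_single ⟨k, h⟩]
      · simp
      · intro j _ hj
        rw [if_neg]
        intro hkj
        exact hj (Fin.ext hkj.symm)
      · simp
    · refine Finset.sum_eq_zero fun j _ => if_neg ?_
      have := j.2
      omega
  have hker : ∀ x, tailProj b n x = 0 ↔ x ∈ LinearMap.range i := by
    intro x
    constructor
    · intro h
      refine ⟨fun j => ⟪b j, x⟫_ℂ, ext_inner_hilbertBasis b fun k => ?_⟩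
      rw [hinner]
      split_ifs with hk
      · rfl
      · have := inner_tailProj b n k x
        rw [h, inner_zero_right, if_neg hk] at this
        exact this
    · rintro ⟨v, rfl⟩
      refine ext_inner_hilbertBasis b fun k => ?_
      rw [inner_tailProj, inner_zero_right, hinner]
      split_ifs <;> rfl
  have hfg : ∀ v, K (i v) = i (Matrix.toLin' (corner b K n) v) := by
    intro v
    refine ext_inner_hilbertBasis b fun k => ?_
    rw [hinner, hi, map_sum, inner_sum]
    simp only [map_smul, inner_smul_right]
    split_ifs with hk
    · simp [Matrix.mulVec, dotProduct, corner, mul_comm]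
    · refine Finset.sum_eq_zero fun j _ => ?_
      rw [hb k j (by have := j.2; omega), mul_zero]
  refine finrank_maxGenEigenspace_eq_of_injective (K : H →ₗ[ℂ] H) (Matrix.toLin' (corner b K n)) i μ
    ?_ hfg fun x hx => ?_
  · intro v w hvw
    funext j
    have h := hinner v j
    rw [hvw, hinner w j, dif_pos j.2, dif_pos j.2] at h
    exact h.symm
  · rw [← hker] at hx ⊢
    obtain ⟨v, hv⟩ := (hker (x - tailProj b n x)).1 (by rw [map_sub, tailProj_tailProj, sub_self])
    have h1 : tailProj b n (K (x - tailProj b n x)) = 0 := by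
      rw [← hv, hfg]
      exact (hker _).2 ⟨_, rfl⟩
    -- By invariance, the tail of `K x` depends only on the tail of `x`.
    have h2 : tailProj b n (K (tailProj b n x)) = μ • tailProj b n x := by
      have h3 : tailProj b n (K x) = μ • tailProj b n x := by
        have := hx
        simp only [ContinuousLinearMap.coe_coe, map_sub, map_smul, sub_eq_zero] at this
        exact this
      rw [← h3, eq_comm, ← sub_eq_zero, ← map_sub, ← map_sub, h1]
    have h4 := hn (tailProj b n x)
    rw [h2, norm_smul] at h4
    by_contra h5
    have := norm_pos_iff.2 h5
    nlinarith

/-- Dually, the tail space is invariant and `K` induces the corner on the quotient. On the tail `K`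
has norm below `‖μ‖`, so `K - μ` is bijective there. -/
theorem algMultiplicity_eq_finrank_corner_of_lower [CompleteSpace H] (b : HilbertBasis ℕ ℂ H) {K : H →L[ℂ] H}
    (hb : ∀ j k : ℕ, j < k → ⟪b j, K (b k)⟫_ℂ = 0) {μ : ℂ} {n : ℕ} {ε : ℝ} (hε0 : 0 ≤ ε)
    (hε : ε < ‖μ‖) (hn : ∀ x, ‖K (tailProj b n x)‖ ≤ ε * ‖x‖) :
    algMultiplicity K μ = finrank ℂ (maxGenEigenspace (Matrix.toLin' (corner b K n)) μ) := by
  classical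
  have hμ : μ ≠ 0 := norm_pos_iff.1 (hε0.trans_lt hε)
  let π : H →ₗ[ℂ] (Fin n → ℂ) := LinearMap.pi fun j => (innerSL ℂ (b j) : H →ₗ[ℂ] ℂ)
  have hπ : ∀ x j, π x j = ⟪b j, x⟫_ℂ := fun x j => rfl
  have hπ0 : ∀ x, π x = 0 ↔ tailProj b n x = x := by
    intro x
    constructor
    · intro h
      exact tailProj_eq_self b fun i hi => congrFun h ⟨i, hi⟩
    · intro h
      funext j
      rw [hπ, ← h, inner_tailProj, if_pos j.2]
      rfl
  have hfg : ∀ x, π (K x) = Matrix.toLin' (corner b K n) (π x) := by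
    intro x
    funext i
    have h1 : ∀ j ∉ Finset.range n, ⟪b i, K (b j)⟫_ℂ * ⟪b j, x⟫_ℂ = 0 := by
      intro j hj
      rw [Finset.mem_range] at hj
      rw [hb i j (by have := i.2; omega), zero_mul]
    rw [hπ, (hasSum_inner_apply b K i x).unique (hasSum_sum_of_ne_finset_zero h1),
      Finset.sum_range]
    rfl
  refine finrank_maxGenEigenspace_eq_of_surjective (K : H →ₗ[ℂ] H) (Matrix.toLin' (corner b K n))
    π μ ?_ hfg ?_ ?_
  · intro v
    refine ⟨∑ j, v j • b j, ?_⟩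
    funext k
    rw [hπ, inner_sum]
    simp only [inner_smul_right, orthonormal_iff_ite.1 b.orthonormal, mul_ite, mul_one, mul_zero]
    rw [Finset.sum_eq_single k]
    · simp
    · intro j _ hj
      rw [if_neg]
      intro hkj
      exact hj (Fin.ext hkj.symm)
    · simp
  · intro x hx h
    have h1 := hn x
    rw [(hπ0 x).1 hx, show K x = μ • x from sub_eq_zero.1 h, norm_smul] at h1
    by_contra h5
    have := norm_pos_iff.2 h5
    nlinarith
  · intro y hy
    have : Nontrivial H := ⟨b 0, 0, b.orthonormal.ne_zero 0⟩
    have hnorm : ‖K ∘L tailProj b n‖ < ‖μ‖ :=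
      (ContinuousLinearMap.opNorm_le_bound _ hε0 hn).trans_lt hε
    -- The inverse exists on all of `H` since `‖K ∘L tailProj b n‖ < ‖μ‖`; applying `π` to the
    -- solved equation then shows that the solution lies in the tail space.
    have hunit : IsUnit (algebraMap ℂ (H →L[ℂ] H) μ - K ∘L tailProj b n) :=
      spectrum.mem_resolventSet_of_norm_lt hnorm
    obtain ⟨u, hu⟩ := hunit
    have hx : (algebraMap ℂ (H →L[ℂ] H) μ - K ∘L tailProj b n) ((↑u⁻¹ : H →L[ℂ] H) (-y)) = -y := by
      rw [← hu, ← mul_apply_eq_comp, Units.mul_inv, one_apply_eq_self]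
    set x := (↑u⁻¹ : H →L[ℂ] H) (-y)
    have hx' : μ • x - K (tailProj b n x) = -y := by
      simpa [Algebra.algebraMap_eq_smul_one] using hx
    have hx0 : π x = 0 := by
      have h1 : π (K (tailProj b n x)) = 0 := by
        rw [hfg, (hπ0 (tailProj b n x)).2 (tailProj_tailProj b n x), map_zero]
      have h2 := congrArg π hx'
      rw [map_sub, h1, map_neg, hy, map_smul, sub_zero, neg_zero] at h2
      exact (smul_eq_zero.1 h2).resolve_left hμ
    refine ⟨x, hx0, ?_⟩
    rw [(hπ0 x).1 hx0] at hx'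
    rw [ContinuousLinearMap.coe_coe, ← neg_sub, hx', neg_neg]

/-- The non-zero diagonal entries of a compact triangular operator are its non-zero eigenvalues,
with algebraic multiplicity. -/
theorem encard_diagonal_eq_algMultiplicity [CompleteSpace H] (b : HilbertBasis ℕ ℂ H) {K : H →L[ℂ] H}
    (hK : IsCompactOperator K)
    (hb : (∀ j k : ℕ, k < j → ⟪b j, K (b k)⟫_ℂ = 0) ∨ (∀ j k : ℕ, j < k → ⟪b j, K (b k)⟫_ℂ = 0))
    {μ : ℂ} (hμ : μ ≠ 0) :
    {n | ⟪b n, K (b n)⟫_ℂ = μ}.encard = algMultiplicity K μ := by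
  classical
  have hμ' : 0 < ‖μ‖ := norm_pos_iff.2 hμ
  -- One cut-off `n` with tail bound `‖μ‖ / 2` does both jobs: the corner carries the full
  -- multiplicity, and no diagonal entry from `n` on equals `μ`.
  obtain ⟨n, hmult, hlt⟩ : ∃ n, algMultiplicity K μ =
      finrank ℂ (maxGenEigenspace (Matrix.toLin' (corner b K n)) μ) ∧
      ∀ m, n ≤ m → ‖⟪b m, K (b m)⟫_ℂ‖ < ‖μ‖ := by
    rcases hb with hb | hb
    · obtain ⟨n, hn⟩ := exists_norm_tailProj_comp_le b hK (half_pos hμ')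
      refine ⟨n, algMultiplicity_eq_finrank_corner_of_upper b hb (half_lt_self hμ') hn,
        fun m hm => ?_⟩
      have h1 : ⟪b m, K (b m)⟫_ℂ = ⟪b m, tailProj b n (K (b m))⟫_ℂ := by
        rw [inner_tailProj, if_neg (by omega)]
      have h2 := norm_inner_le_norm (𝕜 := ℂ) (b m) (tailProj b n (K (b m)))
      have h3 := hn (b m)
      rw [b.orthonormal.1 m] at h2 h3
      rw [h1]
      linarith
    · obtain ⟨n, hn⟩ := exists_norm_comp_tailProj_le b hK (half_pos hμ')
      refine ⟨n, algMultiplicity_eq_finrank_corner_of_lower b hb (half_pos hμ').le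
        (half_lt_self hμ') hn, fun m hm => ?_⟩
      have h1 : tailProj b n (b m) = b m := tailProj_eq_self b fun i hi =>
        b.orthonormal.2 (by omega)
      have h2 := norm_inner_le_norm (𝕜 := ℂ) (b m) (K (b m))
      have h3 := hn (b m)
      rw [h1] at h3
      rw [b.orthonormal.1 m] at h2 h3
      linarith
  have htri : (corner b K n).IsUpperTriangular ∨ (corner b K n).transpose.IsUpperTriangular := by
    rcases hb with hb | hb
    · exact Or.inl fun i j hij => hb i j hij
    · exact Or.inr fun i j hij => hb j i hij
  rw [hmult, finrank_maxGenEigenspace_toLin'_of_isUpperTriangular _ htri]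
  have hset : {m | ⟪b m, K (b m)⟫_ℂ = μ} =
      ((Finset.univ.filter fun i => corner b K n i i = μ).map Fin.valEmbedding : Finset ℕ) := by
    ext m
    simp only [Set.mem_ofPred_eq, Finset.coe_map, Set.mem_image, Finset.mem_coe, Finset.mem_filter,
      Finset.mem_univ, true_and]
    constructor
    · intro hm
      have hmn : m < n := by
        by_contra! h
        have := hlt m h
        rw [hm] at this
        exact lt_irrefl _ this
      exact ⟨⟨m, hmn⟩, hm, rfl⟩
    · rintro ⟨i, hi, rfl⟩
      exact hi
  rw [hset, Set.encard_coe_eq_coe_finsetCard, Finset.card_map]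

end CNumRange

/-! ### From the `C`-spectrum to the `C`-numerical range -/

namespace CNumRange

variable {H : Type*} [NormedAddCommGroup H] [InnerProductSpace ℂ H]

open ContinuousLinearMap

theorem IsModifiedEigenvalueSeq.encard_eq {K : H →L[ℂ] H} {τ : ℕ → ℂ}
    (h : IsModifiedEigenvalueSeq K τ) {μ : ℂ} (hμ : μ ≠ 0) :
    {n | τ n = μ}.encard = algMultiplicity K μ := by
  obtain ⟨e, he, h1, h2, h3⟩ := h
  -- All three cases of the definition place `e` along an injection `φ` and put zeros elsewhere.
  obtain ⟨φ, hφ, hφe, hφ0⟩ : ∃ φ : ℕ → ℕ, Function.Injective φ ∧ (∀ n, τ (φ n) = e n) ∧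
      ∀ m ∉ Set.range φ, τ m = 0 := by
    by_cases hr : FiniteDimensional ℂ K.range
    · exact ⟨id, Function.injective_id, fun n => by rw [h1 hr]; rfl, fun m hm => (hm ⟨m, rfl⟩).elim⟩
    · by_cases hk : FiniteDimensional ℂ K.ker
      · obtain ⟨h4, h5⟩ := h2 hr hk
        refine ⟨fun n => n + Module.finrank ℂ K.ker, add_left_injective _, h5, fun m hm => h4 m ?_⟩
        by_contra! hle
        exact hm ⟨m - Module.finrank ℂ K.ker, Nat.sub_add_cancel hle⟩
      · obtain ⟨φ, hφ, -, h4, h5⟩ := h3 hr hk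
        exact ⟨φ, hφ.injective, h4, h5⟩
  rw [← he.encard_eq μ hμ, ← hφ.encard_image {n | e n = μ}]
  congr 1
  ext m
  constructor
  · intro hm
    by_cases hmr : m ∈ Set.range φ
    · obtain ⟨n, rfl⟩ := hmr
      exact ⟨n, (hφe n).symm.trans hm, rfl⟩
    · exact (hμ ((Eq.symm hm).trans (hφ0 m hmr))).elim
  · rintro ⟨n, hn, rfl⟩
    exact (hφe n).trans hn

theorem inner_apply_eq_zero_of_ne {K : H →L[ℂ] H} (g : HilbertBasis ℕ ℂ H) {d : ℕ → ℂ}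
    (hd : ∀ n, K (g n) = d n • g n) {j k : ℕ} (hjk : j ≠ k) : ⟪g j, K (g k)⟫_ℂ = 0 := by
  rw [hd, inner_smul_right, g.orthonormal.2 hjk, mul_zero]

variable [CompleteSpace H]

/-- A unitary operator can permute one orthonormal basis into another one. -/
theorem exists_unitary_apply_eq (g b : HilbertBasis ℕ ℂ H) (π : Equiv.Perm ℕ) :
    ∃ U ∈ unitary (H →L[ℂ] H), ∀ n, U (g n) = b (π n) := by
  have hspan : (Submodule.span ℂ (Set.range (b ∘ π)))ᗮ = ⊥ := by
    rw [π.surjective.range_comp, ← Submodule.topologicalClosure_eq_top_iff]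
    exact b.dense_span
  let b' := HilbertBasis.mkOfOrthogonalEqBot (b.orthonormal.comp π π.injective) hspan
  refine ⟨_, (Unitary.linearIsometryEquiv.symm (g.repr.trans b'.repr.symm)).2, fun n => ?_⟩
  change b'.repr.symm (g.repr (g n)) = _
  rw [g.repr_self, b'.repr_symm_single, HilbertBasis.coe_mkOfOrthogonalEqBot]
  rfl

/-- Elements of the `C`-spectrum are limits of sums of products of diagonal entries in
triangularising bases. -/
theorem mem_closure_of_mem_cSpectrum {C T : H →L[ℂ] H} (hC : IsTraceClass C)
    (hT : IsCompactOperator T) (g b : HilbertBasis ℕ ℂ H)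
    (hg : (∀ j k : ℕ, k < j → ⟪g j, C (g k)⟫_ℂ = 0) ∨ (∀ j k : ℕ, j < k → ⟪g j, C (g k)⟫_ℂ = 0))
    (hb : (∀ j k : ℕ, k < j → ⟪b j, T (b k)⟫_ℂ = 0) ∨ (∀ j k : ℕ, j < k → ⟪b j, T (b k)⟫_ℂ = 0))
    {z : ℂ} (hz : z ∈ cSpectrum C T) :
    z ∈ closure {w | ∃ π : Equiv.Perm ℕ,
      HasSum (fun n => ⟪g n, C (g n)⟫_ℂ * ⟪b (π n), T (b (π n))⟫_ℂ) w} := by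
  obtain ⟨γ, τ, hγ, hτ, σ, hsum⟩ := hz
  obtain ⟨eγ, heγ⟩ := exists_equiv_support (x := γ) (y := fun n => ⟪g n, C (g n)⟫_ℂ)
    fun μ hμ => (hγ.encard_eq hμ).trans (encard_diagonal_eq_algMultiplicity g hC.1 hg hμ).symm
  obtain ⟨eτ, heτ⟩ := exists_equiv_support (x := τ) (y := fun n => ⟪b n, T (b n)⟫_ℂ)
    fun μ hμ => (hτ.encard_eq hμ).trans (encard_diagonal_eq_algMultiplicity b hT hb hμ).symm
  exact mem_closure_rearrangement_sums eγ heγ eτ heτ (hC.summable_inner g)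
    (tendsto_inner_apply_self b hT) σ hsum

/-- If a unitary `U` mapping `g` to a permutation of `b` makes the diagonal of `C U† T U` the product of
the diagonals of `C` and `T`, then the sum of these products belongs to the `C`-numerical range. -/
theorem mem_cNumericalRange_of_hasSum {C T : H →L[ℂ] H} (hC : IsTraceClass C)
    (g b : HilbertBasis ℕ ℂ H) (π : Equiv.Perm ℕ)
    (hdiag : ∀ U ∈ unitary (H →L[ℂ] H), (∀ n, U (g n) = b (π n)) → ∀ n,
      ⟪g n, C (adjoint U (T (U (g n))))⟫_ℂ = ⟪g n, C (g n)⟫_ℂ * ⟪b (π n), T (b (π n))⟫_ℂ)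
    {w : ℂ} (hw : HasSum (fun n => ⟪g n, C (g n)⟫_ℂ * ⟪b (π n), T (b (π n))⟫_ℂ) w) :
    w ∈ cNumericalRange C T := by
  obtain ⟨U, hU, hUg⟩ := exists_unitary_apply_eq g b π
  obtain ⟨z, hz⟩ := hC.exists_hasTrace_comp (adjoint U ∘L T ∘L U)
  refine ⟨U, hU, ?_⟩
  have h1 : HasSum (fun n => ⟪g n, C (g n)⟫_ℂ * ⟪b (π n), T (b (π n))⟫_ℂ) z := by
    convert! hz g using 2 with n
    exact (hdiag U hU hUg n).symm
  rwa [hw.unique h1]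

end CNumRange

theorem theorem3p4 {H : Type*} [NormedAddCommGroup H] [InnerProductSpace ℂ H] [CompleteSpace H]
    [TopologicalSpace.SeparableSpace H] (hH : ¬ FiniteDimensional ℂ H)
    (C T : H →L[ℂ] H) (hC : CNumRange.IsTraceClass C) (hT : IsCompactOperator T)
    (h : (IsStarNormal C ∧ (CNumRange.IsUpperTriangular T ∨ CNumRange.IsLowerTriangular T)) ∨
      (IsStarNormal T ∧ (CNumRange.IsUpperTriangular C ∨ CNumRange.IsLowerTriangular C))) :
    closure (CNumRange.cSpectrum C T) ⊆ closure (CNumRange.cNumericalRange C T) := by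
  refine closure_minimal (fun z hz => ?_) isClosed_closure
  rcases h with ⟨hN, hb⟩ | ⟨hN, hb⟩
  · obtain ⟨g, c, hg⟩ := CNumRange.exists_hilbertBasis_of_isStarNormal hH hC.1 hN
    obtain ⟨b, hb⟩ : ∃ b : HilbertBasis ℕ ℂ H, (∀ j k : ℕ, k < j → ⟪b j, T (b k)⟫_ℂ = 0) ∨
        (∀ j k : ℕ, j < k → ⟪b j, T (b k)⟫_ℂ = 0) := by
      rcases hb with ⟨b, hb⟩ | ⟨b, hb⟩
      exacts [⟨b, Or.inl hb⟩, ⟨b, Or.inr hb⟩]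
    refine closure_mono ?_ (CNumRange.mem_closure_of_mem_cSpectrum hC hT g b
      (Or.inl fun j k hjk => CNumRange.inner_apply_eq_zero_of_ne g hg hjk.ne') hb hz)
    rintro w ⟨π, hw⟩
    refine CNumRange.mem_cNumericalRange_of_hasSum hC g b π (fun U hU hUg n => ?_) hw
    -- Moving `C` to the left turns it into the scalar `c n`, leaving `⟨U g n, T U g n⟩`.
    rw [← ContinuousLinearMap.adjoint_inner_left, ← ContinuousLinearMap.adjoint_inner_left C (g n),
      CNumRange.adjoint_apply_of_isStarNormal hN (hg n), inner_smul_left, inner_smul_left,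
      ContinuousLinearMap.adjoint_inner_right, hUg, inner_self_eq_norm_sq_to_K, g.orthonormal.1 n]
    simp
  · obtain ⟨b, d, hbd⟩ := CNumRange.exists_hilbertBasis_of_isStarNormal hH hT hN
    obtain ⟨g, hg⟩ : ∃ g : HilbertBasis ℕ ℂ H, (∀ j k : ℕ, k < j → ⟪g j, C (g k)⟫_ℂ = 0) ∨
        (∀ j k : ℕ, j < k → ⟪g j, C (g k)⟫_ℂ = 0) := by
      rcases hb with ⟨b, hb⟩ | ⟨b, hb⟩
      exacts [⟨b, Or.inl hb⟩, ⟨b, Or.inr hb⟩]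
    refine closure_mono ?_ (CNumRange.mem_closure_of_mem_cSpectrum hC hT g b hg
      (Or.inl fun j k hjk => CNumRange.inner_apply_eq_zero_of_ne b hbd hjk.ne') hz)
    rintro w ⟨π, hw⟩
    refine CNumRange.mem_cNumericalRange_of_hasSum hC g b π (fun U hU hUg n => ?_) hw
    -- Since `T` is diagonal in `b`, this makes `g n` an eigenvector of `U† T U` with eigenvalue `d
    -- (π n)`.
    have h1 : ContinuousLinearMap.adjoint U (b (π n)) = g n := by
      rw [← hUg]
      exact DFunLike.congr_fun (Unitary.mem_iff.1 hU).1 (g n)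
    rw [hUg, hbd, map_smul, h1, map_smul, inner_smul_right, inner_smul_right,
      inner_self_eq_norm_sq_to_K, b.orthonormal.1 (π n)]
    simp [mul_comm]
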